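/- All topological spaces are assumed to be completely regular and Hausdorff. For a space $X$ let $\beta X\supseteq X$ be its Stone–Čech compactification, and let $\mathrm{Coz}(X)$ be the set of all cozero-sets of $X$, i.e. the sets $X\setminus f^{-1}(0)$ with $f:X\to[0,1]$ continuous. A mapping is *perfect* if it is continuous and closed and has compact fibers. A topological property $\mathfrak{P}$ is called *compactness-like* if 1. every clopen subspace of a space with $\mathfrak{P}$ has $\mathfrak{P}$; 2. every space that is a finite disjoint union of closed subspaces with $\mathfrak{P}$ has $\mathfrak{P}$; 3. for every perfect surjective mapping $f:S\to T$, the space $S$ has $\mathfrak{P}$ if and only if $T$ has $\mathfrak{P}$; 4. (Mrówka's condition $(\mathrm{W})$) if a space $S$ contains a point $p$ with an open base $\mathscr{B}$ for $S$ at $p$ such that $S\setminus B$ has $\mathfrak{P}$ for each $B\in\mathscr{B}$, then $S$ has $\mathfrak{P}$. A space $X$ is *locally-$\mathfrak{P}$* if each $x\in X$ has an open neighborhood $U$ in $X$ such that $\mathrm{cl}_XU$ has $\mathfrak{P}$, and *non-$\mathfrak{P}$* if it does not have $\mathfrak{P}$. Put $$\lambda_{\mathfrak{P}}X=\bigcup\big\{\mathrm{int}_{\beta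 X}\,\mathrm{cl}_{\beta X}C : C\in\mathrm{Coz}(X)\text{ and }\mathrm{cl}_XC\text{ has }\mathfrak{P}\big\}\subseteq\beta X.$$ An *extension* of $X$ is a space $T$ containing $X$ as a dense subspace; its *remainder* is $T\setminus X$. Two extensions of $X$ are identified if there is a homeomorphism between them that fixes $X$ pointwise. Let $\mathscr{E}_{\mathfrak{P}}(X)$ be the set of all (equivalence classes of) extensions of $X$ that have $\mathfrak{P}$ and have compact remainder, partially ordered by: $T\le T'$ if there is a continuous mapping $T'\to T$ that fixes $X$ pointwise. **Theorem.** Let $\mathfrak{P}$ be a compactness-like topological property and let $X$ and $Y$ be locally compact, locally-$\mathfrak{P}$, non-$\mathfrak{P}$ spaces. If $\mathscr{E}_{\mathfrak{P}}(X)$ and $\mathscr{E}_{\mathfrak{P}}(Y)$ are order-isomorphic, then $\lambda_{\mathfrak{P}}X\setminus X$ and $\lambda_{\mathfrak{P}}Y\setminus Y$ (as subspaces of $\beta X$ and $\beta Y$) are homeomorphic. -/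

import Mathlib

open Set Topology

universe u

namespace CompactRemainder

/-! Every topological space quantified over below is completely regular and Hausdorff
(`T35Space`), which is the standing convention. -/

/-- A predicate on topological spaces. -/
abbrev SpaceProperty : Type (u + 1) := ∀ (X : Type u) [TopologicalSpace X], Prop

/-- A perfect mapping: a closed continuous mapping with compact fibers. -/
def IsPerfectMap {X Y : Type u} [TopologicalSpace X] [TopologicalSpace Y] (f : X → Y) : Prop :=
  Continuous f ∧ IsClosedMap f ∧ ∀ y : Y, IsCompact (f ⁻¹' {y})

/-- Compactness-like topological properties. Invariance under homeomorphisms is a special case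
of invariance under perfect surjections. -/
structure IsCompactnessLike (P : SpaceProperty.{u}) : Prop where
  /-- `P` passes to clopen subspaces. -/
  clopen_hereditary : ∀ (X : Type u) [TopologicalSpace X] [T35Space X] (A : Set X),
    P X → IsClopen A → P A
  /-- A space that is a finite disjoint union of closed subspaces with `P` has `P`. -/
  finitely_additive : ∀ (X : Type u) [TopologicalSpace X] [T35Space X]
    (n : ℕ) (A : Fin n → Set X), (∀ i, IsClosed (A i)) → Pairwise (fun i j => Disjoint (A i) (A j)) →
    (⋃ i, A i) = univ → (∀ i, P (A i)) → P X
  /-- `P` is invariant under perfect surjective mappings. -/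
  perfect_invariant : ∀ (X Y : Type u) [TopologicalSpace X] [T35Space X]
    [TopologicalSpace Y] [T35Space Y] (f : X → Y),
    IsPerfectMap f → Function.Surjective f → P X → P Y
  /-- `P` is inverse invariant under perfect surjective mappings. -/
  perfect_inverse_invariant : ∀ (X Y : Type u) [TopologicalSpace X] [T35Space X]
    [TopologicalSpace Y] [T35Space Y] (f : X → Y),
    IsPerfectMap f → Function.Surjective f → P Y → P X
  /-- Mrówka's condition (W). -/
  mrowka : ∀ (X : Type u) [TopologicalSpace X] [T35Space X] (p : X) (𝓑 : Set (Set X)),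
    (∀ B ∈ 𝓑, IsOpen B ∧ p ∈ B) → (∀ U : Set X, IsOpen U → p ∈ U → ∃ B ∈ 𝓑, B ⊆ U) →
    (∀ B ∈ 𝓑, P (Bᶜ : Set X)) → P X

/-- `X` is locally-`P`: every point has an open neighborhood whose closure has `P`. -/
def IsLocally (P : SpaceProperty.{u}) (X : Type u) [TopologicalSpace X] : Prop :=
  ∀ x : X, ∃ U : Set X, IsOpen U ∧ x ∈ U ∧ P (closure U)

/-- Cozero-sets: complements of zero-sets of continuous mappings into `[0,1]`. -/
def IsCozero {X : Type u} [TopologicalSpace X] (C : Set X) : Prop :=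
  ∃ f : X → unitInterval, Continuous f ∧ C = (f ⁻¹' {0})ᶜ

/-- The subspace `λ_P X` of the Stone–Čech compactification `βX`: the union of the sets
`int_{βX} cl_{βX} C` over all cozero-sets `C` of `X` for which `cl_X C` has `P`. -/
def lam (P : SpaceProperty.{u}) (X : Type u) [TopologicalSpace X] : Set (StoneCech X) :=
  ⋃ C ∈ {C : Set X | IsCozero C ∧ P (closure C)},
    interior (closure ((stoneCechUnit : X → StoneCech X) '' C))

/-- The subspace `λ_P X ∖ X` of `βX`, where `X` is identified with its image in `βX`. -/
def lamRemainder (P : SpaceProperty.{u}) (X : Type u) [TopologicalSpace X] :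
    Set (StoneCech X) :=
  lam P X \ range (stoneCechUnit : X → StoneCech X)

/-- A (completely regular Hausdorff) extension of `X`: a space containing `X` as a dense
subspace. -/
structure Extension (X : Type u) [TopologicalSpace X] : Type (u + 1) where
  /-- The underlying space of the extension. -/
  carrier : Type u
  [top : TopologicalSpace carrier]
  [t35 : T35Space carrier]
  /-- The inclusion of `X`. -/
  incl : X → carrier
  isEmbedding : IsEmbedding incl
  denseRange : DenseRange incl

attribute [instance] Extension.top Extension.t35

/-- The `P`-extensions of `X` with compact remainder, before equivalent ones are identified. -/
def PreExt (P : SpaceProperty.{u}) (X : Type u) [TopologicalSpace X] : Type (u + 1) :=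
  {Y : Extension X // P Y.carrier ∧ IsCompact ((range Y.incl)ᶜ)}

/-- `Y` and `Z` are equivalent: some homeomorphism between them fixes `X` pointwise. -/
def Extension.Equivalent {X : Type u} [TopologicalSpace X] (Y Z : Extension X) : Prop :=
  ∃ h : Y.carrier ≃ₜ Z.carrier, ∀ x, h (Y.incl x) = Z.incl x

/-- `Y ≤ Z`: some continuous mapping of `Z` to `Y` fixes `X` pointwise. -/
def Extension.Le {X : Type u} [TopologicalSpace X] (Y Z : Extension X) : Prop :=
  ∃ f : Z.carrier → Y.carrier, Continuous f ∧ ∀ x, f (Z.incl x) = Y.incl x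

namespace Extension

variable {X : Type u} [TopologicalSpace X]

theorem Equivalent.refl (Y : Extension X) : Y.Equivalent Y :=
  ⟨Homeomorph.refl _, fun _ => rfl⟩

theorem Equivalent.symm {Y Z : Extension X} (h : Y.Equivalent Z) : Z.Equivalent Y := by
  obtain ⟨e, he⟩ := h
  exact ⟨e.symm, fun x => by rw [← he x, e.symm_apply_apply]⟩

theorem Equivalent.trans {Y Z W : Extension X} (h : Y.Equivalent Z) (k : Z.Equivalent W) :
    Y.Equivalent W := by
  obtain ⟨e, he⟩ := h
  obtain ⟨e', he'⟩ := k
  exact ⟨e.trans e', fun x => by rw [Homeomorph.trans_apply, he, he']⟩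

theorem Equivalent.le {Y Z : Extension X} (h : Y.Equivalent Z) : Y.Le Z := by
  obtain ⟨e, he⟩ := h.symm
  exact ⟨e, e.continuous, he⟩

theorem Le.trans {Y Z W : Extension X} (h : Y.Le Z) (k : Z.Le W) : Y.Le W := by
  obtain ⟨f, hf, hf'⟩ := h
  obtain ⟨g, hg, hg'⟩ := k
  exact ⟨f ∘ g, hf.comp hg, fun x => by rw [Function.comp_apply, hg', hf']⟩

theorem Le.antisymm {Y Z : Extension X} (h : Y.Le Z) (k : Z.Le Y) : Y.Equivalent Z := by
  obtain ⟨f, hf, hf'⟩ := h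
  obtain ⟨g, hg, hg'⟩ := k
  have h1 : f ∘ g = id := Y.denseRange.equalizer (hf.comp hg) continuous_id
    (by funext x; simp [hf', hg'])
  have h2 : g ∘ f = id := Z.denseRange.equalizer (hg.comp hf) continuous_id
    (by funext x; simp [hf', hg'])
  exact ⟨{ toFun := g, invFun := f, left_inv := congrFun h1, right_inv := congrFun h2,
           continuous_toFun := hg, continuous_invFun := hf }, hg'⟩

end Extension

/-- Equivalence of `P`-extensions of `X` with compact remainder. -/
instance extSetoid (P : SpaceProperty.{u}) (X : Type u) [TopologicalSpace X] :
    Setoid (PreExt P X) where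
  r Y Z := Y.1.Equivalent Z.1
  iseqv := ⟨fun Y => Extension.Equivalent.refl Y.1, fun h => h.symm, fun h k => h.trans k⟩

/-- `ℰ_P(X)`: the equivalence classes of `P`-extensions of `X` with compact remainder. -/
def ExtSet (P : SpaceProperty.{u}) (X : Type u) [TopologicalSpace X] : Type (u + 1) :=
  Quotient (extSetoid P X)

/-- The standard partial order on `ℰ_P(X)`. -/
instance extPartialOrder (P : SpaceProperty.{u}) (X : Type u) [TopologicalSpace X] :
    PartialOrder (ExtSet P X) where
  le := Quotient.lift₂ (fun Y Z : PreExt P X => Y.1.Le Z.1) fun _ _ _ _ h k =>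
    propext ⟨fun l => (h.symm.le.trans l).trans k.le, fun l => (h.le.trans l).trans k.symm.le⟩
  le_refl := by
    rintro ⟨Y⟩
    exact (Extension.Equivalent.refl Y.1).le
  le_trans := by
    rintro ⟨Y⟩ ⟨Z⟩ ⟨W⟩ h k
    exact Extension.Le.trans h k
  le_antisymm := by
    rintro ⟨Y⟩ ⟨Z⟩ h k
    exact Quotient.sound (Extension.Le.antisymm h k)

end CompactRemainder

/-! Write F = βX ∖ λX and Z = βX ∖ X. An extension T yields a map βX → βT (`Extension.bmap`), which
is injective off the preimage K of the remainder. T is thus encoded by the closed set K and the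
kernel of this map; T ≤ S means that the data of S are contained in those of T (`Extension.le_iff`).

Always K ⊆ Z, and property P forces F ⊆ K (`Extension.lam_compl_subset_rem`). Conversely, for closed
A ⊆ K with F ⊆ K ⊆ Z, the space X ∪ K with A collapsed to a point is an admissible extension: (W)
gives P when A = K, and perfect maps transfer it to every A. No other quotients are needed.
`IsRemainderOrder` records these facts, and the rest is order theory.

The largest element has K = F and trivial kernel. Just below it lie the elements with K = F ∪ {p}
and trivial kernel, one for each point p of Z ∖ F = λX ∖ X, and those with K = F and one pair
identified. The order separates the two kinds. Gluing p to a point of F gives an element below the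
p-element and below no other submaximal one. An element strictly below a pair element either has a
larger K, hence lies below some p-element, or identifies another pair. So the points of λX ∖ X are
the isolated submaximal elements. The sets of points p whose element lies above a given e are
exactly the closed sets, so the order also recovers the topology. -/

namespace CompactRemainder

/-! ### Permanence properties of compactness-like properties -/

namespace IsCompactnessLike

variable {P : SpaceProperty.{u}} {X Y : Type u} [TopologicalSpace X] [T35Space X]
  [TopologicalSpace Y] [T35Space Y]

theorem of_isProperMap (hP : IsCompactnessLike P) {f : X → Y} (hf : IsProperMap f)
    (hs : Function.Surjective f) : P X ↔ P Y := by
  have h : IsPerfectMap f := ⟨hf.continuous, hf.isClosedMap, fun y =>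
    hf.isCompact_preimage isCompact_singleton⟩
  exact ⟨hP.perfect_invariant X Y f h hs, hP.perfect_inverse_invariant X Y f h hs⟩

theorem of_homeomorph (hP : IsCompactnessLike P) (e : X ≃ₜ Y) : P X ↔ P Y :=
  hP.of_isProperMap e.isProperMap e.surjective

/-- The disjoint sum of a finite family of subspaces, as a subspace of a product. -/
abbrev FamilySum {n : ℕ} (A : Fin n → Set X) : Type u := {p : X × Fin n | p.1 ∈ A p.2}

def familySumFiber {n : ℕ} (A : Fin n → Set X) (i : Fin n) :
    {p : FamilySum A | p.1.2 = i} ≃ₜ A i where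
  toFun p := ⟨p.1.1.1, by have h1 := p.1.2; have h2 := p.2; simp only [mem_ofPred_eq] at h1 h2; rwa [h2] at h1⟩
  invFun x := ⟨⟨(x.1, i), x.2⟩, rfl⟩
  left_inv := by rintro ⟨⟨⟨x, j⟩, hx⟩, rfl⟩; rfl
  right_inv _ := rfl
  continuous_toFun := by fun_prop
  continuous_invFun := by fun_prop

omit [T35Space X] in
theorem isClopen_familySum_fiber {n : ℕ} (A : Fin n → Set X) (i : Fin n) :
    IsClopen {p : FamilySum A | p.1.2 = i} :=
  (isClopen_discrete {i}).preimage (f := fun p : FamilySum A => p.1.2) (by fun_prop)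

/-- The projection of the sum to `X` is perfect, because the index factor `Fin n` is compact, and it
is onto because the sets cover. This removes the disjointness from finite additivity. -/
theorem familySum_iff (hP : IsCompactnessLike P) {n : ℕ} {A : Fin n → Set X}
    (hA : ∀ i, IsClosed (A i)) (hu : ⋃ i, A i = univ) : P (FamilySum A) ↔ P X := by
  have hc : IsClosed {p : X × Fin n | p.1 ∈ A p.2} := by
    have : {p : X × Fin n | p.1 ∈ A p.2} = ⋃ i, A i ×ˢ {i} := by
      ext ⟨x, j⟩; simp
    rw [this]
    exact isClosed_iUnion_of_finite fun i => (hA i).prod isClosed_singleton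
  refine hP.of_isProperMap (f := fun p : FamilySum A => p.1.1)
    (isProperMap_fst_of_compactSpace.restrict hc) fun x => ?_
  obtain ⟨i, hi⟩ := mem_iUnion.1 (hu.symm ▸ mem_univ x)
  exact ⟨⟨(x, i), hi⟩, rfl⟩

/-- In the disjoint sum of `X` and `A`, which maps perfectly onto `X`, the summand `A` is clopen. -/
theorem of_isClosed (hP : IsCompactnessLike P) (hX : P X) {A : Set X} (hA : IsClosed A) :
    P A := by
  have h : P (FamilySum ![univ, A]) :=
    (hP.familySum_iff (Fin.forall_fin_two.2 ⟨isClosed_univ, hA⟩)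
      (eq_univ_of_univ_subset (subset_iUnion ![univ, A] 0))).2 hX
  exact (hP.of_homeomorph (familySumFiber ![univ, A] 1)).1
    (hP.clopen_hereditary _ _ h (isClopen_familySum_fiber _ 1))

theorem of_isClosedEmbedding (hP : IsCompactnessLike P) {f : X → Y} (hf : IsClosedEmbedding f)
    (hY : P Y) : P X :=
  (hP.of_homeomorph hf.toIsEmbedding.toHomeomorph).2 (hP.of_isClosed hY hf.isClosed_range)

theorem of_subset (hP : IsCompactnessLike P) {A B : Set X} (hA : IsClosed A) (h : A ⊆ B)
    (hB : P B) : P A :=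
  hP.of_isClosedEmbedding (f := inclusion h)
    ⟨IsEmbedding.inclusion h, by
      rw [range_inclusion]; exact hA.preimage continuous_subtype_val⟩ hB

theorem of_iUnion_eq_univ (hP : IsCompactnessLike P) {n : ℕ} {A : Fin n → Set X}
    (hA : ∀ i, IsClosed (A i)) (hu : ⋃ i, A i = univ) (h : ∀ i, P (A i)) : P X := by
  refine (hP.familySum_iff hA hu).1 (hP.finitely_additive _ n
    (fun i => {p | p.1.2 = i}) (fun i => (isClopen_familySum_fiber A i).isClosed) ?_ ?_
    fun i => (hP.of_homeomorph (familySumFiber A i)).2 (h i))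
  · rintro i j hij
    exact disjoint_left.2 fun p hi hj => hij (hi.symm.trans hj)
  · exact eq_univ_of_forall fun p => mem_iUnion.2 ⟨p.1.2, rfl⟩

theorem union (hP : IsCompactnessLike P) {A B : Set X} (hA : IsClosed A) (hB : IsClosed B)
    (hPA : P A) (hPB : P B) : P (A ∪ B : Set X) := by
  have key : ∀ C : Set X, C ⊆ A ∪ B → IsClosed C → P C →
      P (((↑) : (A ∪ B : Set X) → X) ⁻¹' C) := fun C hC hc hPC => by
    refine hP.of_isClosedEmbedding (f := fun x => (⟨x.1.1, x.2⟩ : C)) ?_ hPC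
    refine ⟨⟨⟨?_⟩, ?_⟩, ?_⟩
    · rw [instTopologicalSpaceSubtype, instTopologicalSpaceSubtype, instTopologicalSpaceSubtype,
        induced_compose, induced_compose]
      rfl
    · rintro ⟨⟨x, _⟩, _⟩ ⟨⟨y, _⟩, _⟩ h
      simpa using h
    · convert isClosed_univ
      exact eq_univ_of_forall fun x => ⟨⟨⟨x.1, hC x.2⟩, x.2⟩, rfl⟩
  refine hP.of_iUnion_eq_univ
    (A := ![((↑) : (A ∪ B : Set X) → X) ⁻¹' A, ((↑) : (A ∪ B : Set X) → X) ⁻¹' B])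
    (Fin.forall_fin_two.2 ⟨hA.preimage continuous_subtype_val,
      hB.preimage continuous_subtype_val⟩) ?_
    (Fin.forall_fin_two.2 ⟨key A subset_union_left hA hPA, key B subset_union_right hB hPB⟩)
  refine eq_univ_of_forall fun x => mem_iUnion.2 ?_
  rcases x.2 with h | h
  · exact ⟨0, h⟩
  · exact ⟨1, h⟩

theorem of_isEmpty (hP : IsCompactnessLike P) [IsEmpty X] : P X :=
  hP.finitely_additive X 0 (fun i => i.elim0) (fun i => i.elim0) (fun i => i.elim0)
    (Subsingleton.elim _ _) fun i => i.elim0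

end IsCompactnessLike

/-! ### The subspace `lam P X` -/

section Lam

variable {P : SpaceProperty.{u}} {X : Type u} [TopologicalSpace X] [T35Space X]

omit [T35Space X] in
theorem isOpen_lam : IsOpen (lam P X) :=
  isOpen_biUnion fun _ _ => isOpen_interior

/-- By compactness finitely many of the open sets defining `lam P X` cover `K`; `N` is the union of
the corresponding closures in `X`. -/
theorem exists_isClosed_of_subset_lam (hP : IsCompactnessLike P) {K : Set (StoneCech X)}
    (hK : IsClosed K) (h : K ⊆ lam P X) :
    ∃ N : Set X, IsClosed N ∧ P N ∧ stoneCechUnit ⁻¹' K ⊆ N := by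
  refine hK.isCompact.induction_on
    (p := fun s => ∃ N : Set X, IsClosed N ∧ P N ∧ stoneCechUnit ⁻¹' s ⊆ N)
    ⟨∅, isClosed_empty, hP.of_isEmpty, by simp⟩ ?_ ?_ ?_
  · rintro s t hst ⟨N, h1, h2, h3⟩
    exact ⟨N, h1, h2, (preimage_mono hst).trans h3⟩
  · rintro s t ⟨N, h1, h2, h3⟩ ⟨N', h1', h2', h3'⟩
    exact ⟨N ∪ N', h1.union h1', hP.union h1 h1' h2 h2', union_subset_union h3 h3'⟩
  · intro x hx
    obtain ⟨C, ⟨-, hC⟩, hxC⟩ := mem_iUnion₂.1 (h hx)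
    refine ⟨_, mem_nhdsWithin_of_mem_nhds (isOpen_interior.mem_nhds hxC), closure C,
      isClosed_closure, hC, fun y hy => ?_⟩
    rw [isInducing_stoneCechUnit.closure_eq_preimage_closure_image]
    exact interior_subset (s := closure (stoneCechUnit '' C)) hy

/-- The cozero-set of `g` in βX is open, so it lies in the closure of its trace on `X`, and that
trace is a cozero-set inside `N`. -/
theorem mem_lam_of_continuous (hP : IsCompactnessLike P) {N : Set X} (hN : IsClosed N)
    (hPN : P N) {g : StoneCech X → unitInterval} (hg : Continuous g)
    (hgN : ∀ x, g (stoneCechUnit x) ≠ 0 → x ∈ N) {z : StoneCech X} (hz : g z ≠ 0) :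
    z ∈ lam P X := by
  refine mem_iUnion₂.2 ⟨((g ∘ stoneCechUnit) ⁻¹' {0})ᶜ,
    ⟨⟨_, hg.comp continuous_stoneCechUnit, rfl⟩, ?_⟩, ?_⟩
  · exact hP.of_subset isClosed_closure (closure_minimal (fun x hx => hgN x hx) hN) hPN
  · refine mem_interior.2 ⟨(g ⁻¹' {0})ᶜ, ?_, (isClosed_singleton.preimage hg).isOpen_compl, hz⟩
    refine ((denseRange_stoneCechUnit (α := X)).open_subset_closure_inter
      (isClosed_singleton.preimage hg).isOpen_compl).trans (closure_mono ?_)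
    rintro _ ⟨hy, x, rfl⟩
    exact ⟨x, hy, rfl⟩

theorem range_subset_lam (hP : IsCompactnessLike P) (hX : IsLocally P X) :
    range (stoneCechUnit : X → StoneCech X) ⊆ lam P X := by
  rintro _ ⟨x, rfl⟩
  obtain ⟨U, hU, hxU, hPU⟩ := hX x
  obtain ⟨f, hf, hfx, hfU⟩ := CompletelyRegularSpace.completely_regular_isOpen x U hU hxU
  have hf' : Continuous fun y => unitInterval.symm (f y) := by fun_prop
  refine mem_lam_of_continuous hP isClosed_closure hPU (continuous_stoneCechExtend hf') ?_ ?_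
  · intro y hy
    refine subset_closure (by_contra fun hyU => hy ?_)
    simp [stoneCechExtend_stoneCechUnit, hfU hyU]
  · simp [stoneCechExtend_stoneCechUnit, hfx]

theorem lam_compl_nonempty (hP : IsCompactnessLike P) (hX : ¬ P X) : ((lam P X)ᶜ).Nonempty := by
  rw [nonempty_compl]
  intro h
  obtain ⟨N, -, hPN, hN⟩ := exists_isClosed_of_subset_lam hP isClosed_univ h.ge
  obtain rfl : N = univ := univ_subset_iff.1 hN
  exact hX ((hP.of_homeomorph (Homeomorph.Set.univ X)).1 hPN)

/-- A compact neighborhood of a point of `X` contains the trace of an open `V` in βX. This trace is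
dense in `V`, and the compact set is closed in βX, so it contains `V`. -/
theorem isOpen_range_stoneCechUnit [LocallyCompactSpace X] :
    IsOpen (range (stoneCechUnit : X → StoneCech X)) := by
  rw [isOpen_iff_mem_nhds]
  rintro _ ⟨x, rfl⟩
  obtain ⟨L, hL, hxL⟩ := exists_compact_mem_nhds x
  rw [isInducing_stoneCechUnit.nhds_eq_comap] at hxL
  obtain ⟨W, hW, hWL⟩ := hxL
  obtain ⟨V, hVW, hV, hxV⟩ := mem_nhds_iff.1 hW
  refine mem_nhds_iff.2 ⟨V, ?_, hV, hxV⟩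
  have hc : IsClosed ((stoneCechUnit : X → StoneCech X) '' L) :=
    (hL.image continuous_stoneCechUnit).isClosed
  refine ((denseRange_stoneCechUnit (α := X)).open_subset_closure_inter hV).trans
    ((closure_minimal ?_ hc).trans (image_subset_range _ _))
  rintro _ ⟨hy, y, rfl⟩
  exact ⟨y, hWL (hVW hy), rfl⟩

end Lam

/-- A continuous extension of an embedding to a space in which the domain is dense sends no
further point into the range of the embedding. -/
theorem eq_of_extends_isEmbedding {X S T : Type*} [TopologicalSpace X] [TopologicalSpace S]
    [T2Space S] [TopologicalSpace T] {i : X → S} (hi : Continuous i) (hd : DenseRange i)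
    {j : X → T} (hj : IsEmbedding j) {g : S → T} (hg : Continuous g) (hgi : ∀ x, g (i x) = j x)
    {s : S} {x : X} (h : g s = j x) : s = i x := by
  by_contra hne
  obtain ⟨U, V, hU, hV, hsU, hxV, hUV⟩ := t2_separation hne
  obtain ⟨W, hW, hWV⟩ := hj.isInducing.isOpen_iff.1 (hV.preimage hi)
  have hxW : x ∈ j ⁻¹' W := hWV ▸ hxV
  obtain ⟨y, hyU, hyW⟩ := hd.exists_mem_open (hU.inter (hW.preimage hg))
    ⟨s, hsU, show g s ∈ W from h ▸ hxW⟩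
  have hyW' : y ∈ j ⁻¹' W := by
    have : g (i y) ∈ W := hyW
    rwa [hgi] at this
  rw [hWV] at hyW'
  exact disjoint_left.1 hUV hyU hyW'

/-! ### Encoding an extension by a closed subset of βX and a kernel -/

namespace Extension

variable {X : Type u} [TopologicalSpace X]

/-- The continuous extension `βX → βT` of the inclusion of `X` in an extension `T`. -/
noncomputable def bmap (T : Extension X) : StoneCech X → StoneCech T.carrier :=
  stoneCechExtend (continuous_stoneCechUnit.comp T.isEmbedding.continuous)

/-- The preimage in `βX` of the remainder of an extension. -/
def rem (T : Extension X) : Set (StoneCech X) :=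
  T.bmap ⁻¹' (stoneCechUnit '' (range T.incl)ᶜ)

theorem continuous_bmap (T : Extension X) : Continuous T.bmap :=
  continuous_stoneCechExtend _

@[simp]
theorem bmap_stoneCechUnit (T : Extension X) (x : X) :
    T.bmap (stoneCechUnit x) = stoneCechUnit (T.incl x) :=
  stoneCechExtend_stoneCechUnit _ x

theorem isClosedMap_bmap (T : Extension X) : IsClosedMap T.bmap :=
  T.continuous_bmap.isClosedMap

theorem surjective_bmap (T : Extension X) : Function.Surjective T.bmap := by
  rw [← range_eq_univ, ← T.isClosedMap_bmap.isClosed_range.closure_eq]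
  have hd : DenseRange ((stoneCechUnit : T.carrier → StoneCech T.carrier) ∘ T.incl) :=
    denseRange_stoneCechUnit.comp T.denseRange continuous_stoneCechUnit
  refine eq_univ_of_univ_subset (hd.closure_range.ge.trans (closure_mono ?_))
  rintro _ ⟨x, rfl⟩
  exact ⟨stoneCechUnit x, T.bmap_stoneCechUnit x⟩

theorem eq_of_bmap_eq (T : Extension X) {z : StoneCech X} {x : X}
    (h : T.bmap z = stoneCechUnit (T.incl x)) : z = stoneCechUnit x :=
  eq_of_extends_isEmbedding continuous_stoneCechUnit denseRange_stoneCechUnit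
    (isEmbedding_stoneCechUnit.comp T.isEmbedding) T.continuous_bmap T.bmap_stoneCechUnit h

theorem isClosed_rem {T : Extension X} (hT : IsCompact (range T.incl)ᶜ) : IsClosed T.rem :=
  (hT.image continuous_stoneCechUnit).isClosed.preimage T.continuous_bmap

theorem disjoint_rem (T : Extension X) : Disjoint T.rem (range stoneCechUnit) := by
  rw [disjoint_right]
  rintro _ ⟨x, rfl⟩ ⟨t, ht, h⟩
  rw [bmap_stoneCechUnit] at h
  exact ht ⟨x, (injective_stoneCechUnit_of_t35Space h).symm⟩

/-- Off `T.rem`, a function on βX separating `z` from `w` can be chosen constant on `T.rem`; it then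
descends to `T`, so `T.bmap` separates the two points. -/
theorem mem_rem_of_bmap_eq {T : Extension X} (hT : IsCompact (range T.incl)ᶜ)
    {z w : StoneCech X} (hne : z ≠ w) (h : T.bmap z = T.bmap w) : z ∈ T.rem := by
  by_contra hz
  obtain ⟨f, hf, hfz, hfw⟩ := CompletelyRegularSpace.completely_regular z (T.rem ∪ {w})
    ((isClosed_rem hT).union isClosed_singleton) (by simp [hz, hne])
  classical
  let g : T.carrier → unitInterval := fun t =>
    if ht : ∃ x, T.incl x = t then f (stoneCechUnit ht.choose) else 1
  have hg1 : ∀ x, g (T.incl x) = f (stoneCechUnit x) := fun x => by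
    have hx : ∃ y, T.incl y = T.incl x := ⟨x, rfl⟩
    simp only [g, dif_pos hx]
    rw [T.isEmbedding.injective hx.choose_spec]
  have hg2 : ∀ t, t ∉ range T.incl → g t = 1 := fun t ht => dif_neg ht
  -- Since `f` is 1 on `T.rem`, it is constant on the fibers over points of `T`. Continuity of `g`
  -- then follows from closedness of `T.bmap`.
  have hpre : ∀ C : Set unitInterval, g ⁻¹' C = stoneCechUnit ⁻¹' (T.bmap '' (f ⁻¹' C)) := by
    intro C
    ext t
    by_cases ht : t ∈ range T.incl
    · obtain ⟨x, rfl⟩ := ht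
      rw [mem_preimage, hg1]
      constructor
      · exact fun hx => ⟨_, hx, T.bmap_stoneCechUnit x⟩
      · rintro ⟨y, hy, hyx⟩
        rwa [T.eq_of_bmap_eq hyx] at hy
    · rw [mem_preimage, hg2 t ht]
      have hrem : ∀ y, T.bmap y = stoneCechUnit t → f y = 1 := fun y hy =>
        hfw (Or.inl ⟨t, ht, hy.symm⟩)
      constructor
      · intro h1
        obtain ⟨y, hy⟩ := T.surjective_bmap (stoneCechUnit t)
        exact ⟨y, by rwa [mem_preimage, hrem y hy], hy⟩
      · rintro ⟨y, hy, hyt⟩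
        rwa [mem_preimage, hrem y hyt] at hy
  have hg : Continuous g := continuous_iff_isClosed.2 fun C hC => by
    rw [hpre]
    exact (T.isClosedMap_bmap _ (hC.preimage hf)).preimage continuous_stoneCechUnit
  have hext : stoneCechExtend hg ∘ T.bmap = f :=
    stoneCech_hom_ext ((continuous_stoneCechExtend hg).comp T.continuous_bmap) hf (by
      funext x
      simp [stoneCechExtend_stoneCechUnit, hg1])
  have hzw : f z = f w := by rw [← hext]; simp [h]
  rw [hfz, hfw (Or.inr rfl)] at hzw
  simp at hzw

theorem le_iff {T S : Extension X} :
    T.Le S ↔ S.rem ⊆ T.rem ∧ ∀ z w, S.bmap z = S.bmap w → T.bmap z = T.bmap w := by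
  constructor
  · rintro ⟨f, hf, hfx⟩
    have hc : Continuous ((stoneCechUnit : T.carrier → StoneCech T.carrier) ∘ f) :=
      continuous_stoneCechUnit.comp hf
    have key : stoneCechExtend hc ∘ S.bmap = T.bmap :=
      stoneCech_hom_ext ((continuous_stoneCechExtend hc).comp S.continuous_bmap)
        T.continuous_bmap (by funext x; simp [stoneCechExtend_stoneCechUnit, hfx])
    refine ⟨?_, fun z w h => by rw [← key]; simp [h]⟩
    rintro z ⟨s, hs, hsz⟩
    refine ⟨f s, ?_, by rw [← key]; simp [← hsz, stoneCechExtend_stoneCechUnit]⟩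
    rintro ⟨x, hx⟩
    exact hs ⟨x, (eq_of_extends_isEmbedding S.isEmbedding.continuous S.denseRange T.isEmbedding
      hf hfx hx.symm).symm⟩
  · rintro ⟨hrem, hker⟩
    have hq : IsQuotientMap S.bmap :=
      S.isClosedMap_bmap.isQuotientMap S.continuous_bmap S.surjective_bmap
    let g : C(StoneCech S.carrier, StoneCech T.carrier) :=
      hq.lift (f := ⟨S.bmap, S.continuous_bmap⟩) ⟨T.bmap, T.continuous_bmap⟩ hker
    have hg : ∀ z, g (S.bmap z) = T.bmap z := fun z =>
      DFunLike.congr_fun (hq.lift_comp (f := ⟨S.bmap, S.continuous_bmap⟩)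
        ⟨T.bmap, T.continuous_bmap⟩ hker) z
    -- The inclusion of the remainders' preimages ensures that `g` maps `S` into `T` and not merely
    -- into βT.
    have hex : ∀ s : S.carrier, ∃ t : T.carrier, stoneCechUnit t = g (stoneCechUnit s) := by
      intro s
      by_cases hs : s ∈ range S.incl
      · obtain ⟨x, rfl⟩ := hs
        exact ⟨T.incl x, by rw [← S.bmap_stoneCechUnit, hg, T.bmap_stoneCechUnit]⟩
      · obtain ⟨z, hz⟩ := S.surjective_bmap (stoneCechUnit s)
        obtain ⟨t, -, ht⟩ := hrem ⟨s, hs, hz.symm⟩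
        exact ⟨t, by rw [← hz, hg, ht]⟩
    choose f hf using hex
    refine ⟨f, ?_, fun x => injective_stoneCechUnit_of_t35Space ?_⟩
    · rw [isInducing_stoneCechUnit.continuous_iff]
      exact (g.continuous.comp continuous_stoneCechUnit).congr fun s => (hf s).symm
    · rw [hf, ← S.bmap_stoneCechUnit, hg, T.bmap_stoneCechUnit]

/-- A point off `T.rem` has image separated from the compact remainder by a function; a sublevel set
of it is closed in `T` and contained in `X`, hence inherits `P`. -/
theorem lam_compl_subset_rem {P : SpaceProperty.{u}} (hP : IsCompactnessLike P) [T35Space X]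
    {T : Extension X} (hPT : P T.carrier) (hT : IsCompact (range T.incl)ᶜ) :
    (lam P X)ᶜ ⊆ T.rem := by
  intro z hz
  by_contra hzT
  refine hz ?_
  obtain ⟨f, hf, hfz, hf1⟩ := CompletelyRegularSpace.completely_regular (T.bmap z)
    (stoneCechUnit '' (range T.incl)ᶜ) (hT.image continuous_stoneCechUnit).isClosed hzT
  -- `k` is nonzero exactly for t < 1/2, so the cozero-set of the composite has its trace on `X`
  -- inside `N`.
  let k : unitInterval → unitInterval := fun t =>
    ⟨max 0 (1 - 2 * t), le_max_left _ _, max_le zero_le_one (by linarith [t.2.1])⟩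
  have hk : Continuous k := by fun_prop
  have hk0 : ∀ t : unitInterval, k t ≠ 0 → (t : ℝ) ≤ 1 / 2 := by
    intro t ht
    by_contra! h
    exact ht (Subtype.ext (max_eq_left (by linarith)))
  let N : Set X := {x | (f (stoneCechUnit (T.incl x)) : ℝ) ≤ 1 / 2}
  have hcl : IsClosed {t : T.carrier | (f (stoneCechUnit t) : ℝ) ≤ 1 / 2} :=
    isClosed_le (continuous_subtype_val.comp (hf.comp continuous_stoneCechUnit)) continuous_const
  have hNc : IsClosed N := hcl.preimage T.isEmbedding.continuous
  have hPN : P N := by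
    refine hP.of_isClosedEmbedding (f := fun x : N => T.incl x)
      ⟨T.isEmbedding.comp IsEmbedding.subtypeVal, ?_⟩ hPT
    convert hcl
    ext t
    constructor
    · rintro ⟨x, rfl⟩
      exact x.2
    · intro ht
      by_cases htr : t ∈ range T.incl
      · obtain ⟨x, rfl⟩ := htr
        exact ⟨⟨x, ht⟩, rfl⟩
      · have h1 : f (stoneCechUnit t) = 1 := hf1 ⟨t, htr, rfl⟩
        have ht' : (f (stoneCechUnit t) : ℝ) ≤ 1 / 2 := ht
        rw [h1] at ht'
        norm_num at ht'
  refine mem_lam_of_continuous hP hNc hPN (hk.comp (hf.comp T.continuous_bmap)) ?_ ?_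
  · intro x hx
    have h := hk0 _ hx
    rwa [Function.comp_apply, bmap_stoneCechUnit] at h
  · rw [Function.comp_apply, Function.comp_apply, hfz]
    intro h
    have := congrArg Subtype.val h
    simp [k] at this

end Extension

/-! ### Collapsing a closed subset of a compact space to a point -/

section Collapse

variable {B : Type u} [TopologicalSpace B]

/-- The continuous mappings into `[0,1]` that are constant on `A`. -/
abbrev ConstOn (A : Set B) : Type u :=
  {f : C(B, unitInterval) // ∀ a ∈ A, ∀ b ∈ A, f a = f b}

/-- Evaluation at the continuous mappings that are constant on `A`. -/
def collapse (A : Set B) (z : B) : ConstOn A → unitInterval := fun f => f.1 z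

theorem continuous_collapse (A : Set B) : Continuous (collapse A) :=
  continuous_pi fun f => f.1.continuous

variable [CompactSpace B] [T2Space B]

omit [T2Space B] in
theorem isProperMap_collapse (A : Set B) : IsProperMap (collapse A) :=
  (continuous_collapse A).isProperMap

/-- The image of `collapse A` is thus the quotient of `B` by `A`, realized in a cube, so that its
subspaces are completely regular and Hausdorff at once. -/
theorem collapse_eq_iff {A : Set B} (hA : IsClosed A) {z w : B} :
    collapse A z = collapse A w ↔ z = w ∨ z ∈ A ∧ w ∈ A := by
  constructor
  · have key : ∀ z w : B, z ≠ w → z ∉ A → collapse A z ≠ collapse A w := by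
      intro z w hne hz h
      obtain ⟨f, hf, hfz, hf1⟩ := CompletelyRegularSpace.completely_regular z (A ∪ {w})
        (hA.union isClosed_singleton) (by simp [hz, hne])
      have h1 : f z = f w := congrFun h ⟨⟨f, hf⟩, fun a ha b hb =>
        (hf1 (Or.inl ha)).trans (hf1 (Or.inl hb)).symm⟩
      rw [hfz, hf1 (Or.inr rfl)] at h1
      simp at h1
    intro h
    by_contra! hne
    by_cases hz : z ∈ A
    · exact key w z hne.1.symm (hne.2 hz) h.symm
    · exact key z w hne.1 hz h
  · rintro (rfl | ⟨hz, hw⟩)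
    · rfl
    · exact funext fun f => f.2 z hz w hw

theorem collapse_mem_image_iff {A S : Set B} (hA : IsClosed A) (hAS : A ⊆ S) {z : B} :
    collapse A z ∈ collapse A '' S ↔ z ∈ S := by
  constructor
  · rintro ⟨w, hw, h⟩
    rcases (collapse_eq_iff hA).1 h with rfl | h
    · exact hw
    · exact hAS h.2
  · exact fun hz => ⟨z, hz, rfl⟩

end Collapse

/-! ### Extensions obtained from the Stone–Čech compactification -/

section CollapseExt

variable {X : Type u} [TopologicalSpace X] [T35Space X] {K A : Set (StoneCech X)}

omit [T35Space X] in
theorem collapse_stoneCechUnit_eq_iff (hA : IsClosed A) (hAX : Disjoint A (range stoneCechUnit))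
    {z : StoneCech X} {x : X} :
    collapse A z = collapse A (stoneCechUnit x) ↔ z = stoneCechUnit x := by
  rw [collapse_eq_iff hA]
  exact or_iff_left fun h => disjoint_left.1 hAX h.2 ⟨x, rfl⟩

/-- A closed subset of `X` is the trace of a closed `D` in βX. Fibers over `X` are singletons, so
the closed image of `D` has the same trace. -/
theorem isEmbedding_collapse_stoneCechUnit (hA : IsClosed A)
    (hAX : Disjoint A (range stoneCechUnit)) :
    IsEmbedding fun x : X => collapse A (stoneCechUnit x) := by
  have hc : Continuous fun x : X => collapse A (stoneCechUnit x) :=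
    (continuous_collapse A).comp continuous_stoneCechUnit
  refine ⟨⟨le_antisymm hc.le_induced fun U hU => ?_⟩, fun x y h =>
    injective_stoneCechUnit_of_t35Space ((collapse_stoneCechUnit_eq_iff hA hAX).1 h)⟩
  obtain ⟨D, hD, hDU⟩ := isInducing_stoneCechUnit.isClosed_iff.1 hU.isClosed_compl
  refine ⟨(collapse A '' D)ᶜ, ((isProperMap_collapse A).isClosedMap D hD).isOpen_compl, ?_⟩
  ext x
  rw [preimage_compl, ← compl_compl U, mem_compl_iff, mem_compl_iff, ← hDU, not_iff_not]
  constructor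
  · rintro ⟨z, hz, h⟩
    rwa [(collapse_stoneCechUnit_eq_iff hA hAX).1 h] at hz
  · exact fun hx => ⟨_, hx, rfl⟩

/-- The extension of `X` that arises from the subspace `X ∪ K` of `βX` when `A ⊆ K` is
collapsed to a point. -/
def collapseExt (hA : IsClosed A) (hAK : A ⊆ K) (hK : Disjoint K (range stoneCechUnit)) :
    Extension X where
  carrier := collapse A '' (range stoneCechUnit ∪ K)
  incl x := ⟨collapse A (stoneCechUnit x), mem_image_of_mem _ (Or.inl ⟨x, rfl⟩)⟩
  isEmbedding := .of_comp
    (((continuous_collapse A).comp continuous_stoneCechUnit).subtype_mk _) continuous_subtype_val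
    (isEmbedding_collapse_stoneCechUnit hA (hK.mono_left hAK))
  denseRange := by
    rintro ⟨_, z, hz, rfl⟩
    rw [closure_subtype]
    have h1 := image_closure_subset_closure_image (continuous_collapse A)
      (mem_image_of_mem (collapse A) (denseRange_stoneCechUnit (α := X) z))
    rw [← range_comp] at h1 ⊢
    exact h1

variable (hA : IsClosed A) (hAK : A ⊆ K) (hK : Disjoint K (range stoneCechUnit))

/-- The quotient mapping of `X ∪ K`. -/
def collapseExtMk (z : (range (stoneCechUnit : X → StoneCech X) ∪ K : Set (StoneCech X))) :
    (collapseExt hA hAK hK).carrier :=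
  ⟨collapse A z, mem_image_of_mem _ z.2⟩

theorem continuous_collapseExtMk : Continuous (collapseExtMk hA hAK hK) :=
  ((continuous_collapse A).comp continuous_subtype_val).subtype_mk _

theorem surjective_collapseExtMk : Function.Surjective (collapseExtMk hA hAK hK) := by
  rintro ⟨_, z, hz, rfl⟩
  exact ⟨⟨z, hz⟩, rfl⟩

/-- As `A ⊆ K`, the set X ∪ K is saturated, and a perfect map restricts to a perfect map on a
saturated set. -/
theorem isProperMap_collapseExtMk : IsProperMap (collapseExtMk hA hAK hK) := by
  have hmem : ∀ {z : StoneCech X}, collapse A z ∈ collapse A '' (range stoneCechUnit ∪ K) ↔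
      z ∈ range stoneCechUnit ∪ K := collapse_mem_image_iff hA (hAK.trans subset_union_right)
  rw [isProperMap_iff_isClosedMap_and_compact_fibers]
  refine ⟨continuous_collapseExtMk hA hAK hK, ?_, ?_⟩
  · intro C hC
    obtain ⟨D, hD, rfl⟩ := isClosed_induced_iff.1 hC
    have himg : collapseExtMk hA hAK hK '' (Subtype.val ⁻¹' D) =
        Subtype.val ⁻¹' (collapse A '' D) := ?_
    · rw [himg]
      exact ((isProperMap_collapse A).isClosedMap D hD).preimage continuous_subtype_val
    ext ⟨t, ht⟩
    constructor
    · rintro ⟨z, hz, h⟩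
      exact ⟨z, hz, congrArg Subtype.val h⟩
    · rintro ⟨z, hz, rfl⟩
      exact ⟨⟨z, hmem.1 ht⟩, hz, rfl⟩
  · intro t
    rw [Subtype.isCompact_iff]
    convert (isProperMap_collapse A).isCompact_preimage (isCompact_singleton (x := t.1))
    ext z
    constructor
    · rintro ⟨w, hw, rfl⟩
      exact congrArg Subtype.val hw
    · intro hz
      have hz' : collapse A z = t.1 := hz
      exact ⟨⟨z, hmem.1 (hz' ▸ t.2)⟩, Subtype.ext hz', rfl⟩

theorem collapseExt_bmap (z : (range (stoneCechUnit : X → StoneCech X) ∪ K : Set (StoneCech X))) :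
    (collapseExt hA hAK hK).bmap z = stoneCechUnit (collapseExtMk hA hAK hK z) := by
  let i : X → (range (stoneCechUnit : X → StoneCech X) ∪ K : Set (StoneCech X)) :=
    fun x => ⟨stoneCechUnit x, Or.inl ⟨x, rfl⟩⟩
  have hi : DenseRange i := fun z => by
    rw [closure_subtype, ← range_comp]
    exact denseRange_stoneCechUnit z.1
  exact congrFun (hi.equalizer
    ((collapseExt hA hAK hK).continuous_bmap.comp continuous_subtype_val)
    (continuous_stoneCechUnit.comp (continuous_collapseExtMk hA hAK hK))
    (funext fun x => (collapseExt hA hAK hK).bmap_stoneCechUnit x)) z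

/-- The inclusion of the extension in the cube extends over its Stone–Čech compactification, so
`collapse A` factors through `bmap`. -/
theorem collapse_eq_of_collapseExt_bmap_eq {z w : StoneCech X}
    (h : (collapseExt hA hAK hK).bmap z = (collapseExt hA hAK hK).bmap w) :
    collapse A z = collapse A w := by
  have hc : Continuous fun t : (collapseExt hA hAK hK).carrier => t.1 := continuous_subtype_val
  have key : stoneCechExtend hc ∘ (collapseExt hA hAK hK).bmap = collapse A :=
    stoneCech_hom_ext ((continuous_stoneCechExtend hc).comp
      (collapseExt hA hAK hK).continuous_bmap) (continuous_collapse A)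
      (by funext x; simp [stoneCechExtend_stoneCechUnit]; rfl)
  rw [← key]
  simp [h]

theorem collapseExtMk_mem_range_iff
    (z : (range (stoneCechUnit : X → StoneCech X) ∪ K : Set (StoneCech X))) :
    collapseExtMk hA hAK hK z ∈ range (collapseExt hA hAK hK).incl ↔ z.1 ∉ K := by
  constructor
  · rintro ⟨x, hx⟩ hz
    have h := (collapse_stoneCechUnit_eq_iff hA (hK.mono_left hAK)).1
      (congrArg Subtype.val hx).symm
    exact disjoint_left.1 hK hz ⟨x, h.symm⟩
  · intro hz
    obtain ⟨x, hx⟩ := z.2.resolve_right hz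
    exact ⟨x, Subtype.ext (congrArg (collapse A) hx)⟩

theorem isCompact_compl_range_collapseExt (hKc : IsClosed K) :
    IsCompact (range (collapseExt hA hAK hK).incl)ᶜ := by
  have hc : IsCompact
      (((↑) : (range (stoneCechUnit : X → StoneCech X) ∪ K : Set _) → StoneCech X) ⁻¹' K) := by
    rw [Subtype.isCompact_iff, Subtype.image_preimage_coe,
      inter_eq_right.2 subset_union_right]
    exact hKc.isCompact
  convert hc.image (continuous_collapseExtMk hA hAK hK)
  ext t
  obtain ⟨z, rfl⟩ := surjective_collapseExtMk hA hAK hK t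
  rw [mem_compl_iff, collapseExtMk_mem_range_iff, not_not]
  refine ⟨fun hz => ⟨z, hz, rfl⟩, ?_⟩
  rintro ⟨w, hw, h⟩
  by_contra hz
  rw [← collapseExtMk_mem_range_iff hA hAK hK, ← h, collapseExtMk_mem_range_iff] at hz
  exact hz hw

theorem collapseExt_bmap_eq_iff {z w : StoneCech X} :
    (collapseExt hA hAK hK).bmap z = (collapseExt hA hAK hK).bmap w ↔ z = w ∨ z ∈ A ∧ w ∈ A := by
  refine ⟨fun h => (collapse_eq_iff hA).1 (collapse_eq_of_collapseExt_bmap_eq hA hAK hK h), ?_⟩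
  rintro (rfl | ⟨hz, hw⟩)
  · rfl
  · rw [collapseExt_bmap hA hAK hK ⟨z, Or.inr (hAK hz)⟩,
      collapseExt_bmap hA hAK hK ⟨w, Or.inr (hAK hw)⟩]
    exact congrArg _ (Subtype.ext ((collapse_eq_iff hA).2 (Or.inr ⟨hz, hw⟩)))

theorem collapseExt_rem : (collapseExt hA hAK hK).rem = K := by
  ext z
  constructor
  · rintro ⟨t, ht, h⟩
    obtain ⟨w, rfl⟩ := surjective_collapseExtMk hA hAK hK t
    rw [mem_compl_iff, collapseExtMk_mem_range_iff, not_not] at ht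
    rw [← collapseExt_bmap] at h
    rcases (collapseExt_bmap_eq_iff hA hAK hK).1 h with rfl | h
    · exact ht
    · exact hAK h.2
  · intro hz
    refine ⟨_, ?_, (collapseExt_bmap hA hAK hK ⟨z, Or.inr hz⟩).symm⟩
    rw [mem_compl_iff, collapseExtMk_mem_range_iff, not_not]
    exact hz

/-- Condition (W) is applied at the point to which `K` collapses. The complement of a neighborhood
of it is a closed subset of `X` lying in a compact subset of `lam P X`. -/
theorem collapseExt_self_prop {P : SpaceProperty.{u}} (hP : IsCompactnessLike P)
    (hKc : IsClosed K) (hK0 : K.Nonempty) (hlam : (lam P X)ᶜ ⊆ K) :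
    P (collapseExt hKc subset_rfl hK).carrier := by
  obtain ⟨k, hk⟩ := hK0
  refine hP.mrowka _ (collapseExtMk hKc subset_rfl hK ⟨k, Or.inr hk⟩)
    {B | IsOpen B ∧ collapseExtMk hKc subset_rfl hK ⟨k, Or.inr hk⟩ ∈ B} (fun B hB => hB)
    (fun U hU hpU => ⟨U, ⟨hU, hpU⟩, subset_rfl⟩) ?_
  rintro B ⟨hB, hkB⟩
  have hM : IsClosed {x | (collapseExt hKc subset_rfl hK).incl x ∉ B} :=
    (hB.preimage (collapseExt hKc subset_rfl hK).isEmbedding.continuous).isClosed_compl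
  have hPM : P {x | (collapseExt hKc subset_rfl hK).incl x ∉ B} := by
    obtain ⟨V, hV, rfl⟩ := isOpen_induced_iff.1 hB
    obtain ⟨N, -, hPN, hN⟩ := exists_isClosed_of_subset_lam hP
      (hV.preimage (continuous_collapse K)).isClosed_compl (fun z hz => by
        by_contra hzl
        have h : collapse K z = collapse K k := (collapse_eq_iff hKc).2 (Or.inr ⟨hlam hzl, hk⟩)
        exact hz (show collapse K z ∈ V from h ▸ hkB))
    exact hP.of_subset hM (fun x hx => hN hx) hPN
  have himg : (collapseExt hKc subset_rfl hK).incl ''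
      {x | (collapseExt hKc subset_rfl hK).incl x ∉ B} = Bᶜ := by
    ext t
    constructor
    · rintro ⟨x, hx, rfl⟩
      exact hx
    · intro ht
      obtain ⟨z, rfl⟩ := surjective_collapseExtMk hKc subset_rfl hK t
      have hz : z.1 ∉ K := fun hz => ht (by
        convert hkB using 1
        exact Subtype.ext ((collapse_eq_iff hKc).2 (Or.inr ⟨hz, hk⟩)))
      obtain ⟨x, hx⟩ := (collapseExtMk_mem_range_iff hKc subset_rfl hK z).2 hz
      refine ⟨x, ?_, hx⟩
      rw [← hx] at ht
      exact ht
  rw [← himg]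
  exact (hP.of_homeomorph
    ((collapseExt hKc subset_rfl hK).isEmbedding.homeomorphImage _)).1 hPM

/-- X ∪ K maps perfectly onto both quotients, so `P` passes from the collapse of `K` up to X ∪ K and
down to the collapse of `A`. -/
theorem collapseExt_prop {P : SpaceProperty.{u}} (hP : IsCompactnessLike P) (hKc : IsClosed K)
    (hK0 : K.Nonempty) (hlam : (lam P X)ᶜ ⊆ K) : P (collapseExt hA hAK hK).carrier :=
  (hP.of_isProperMap (isProperMap_collapseExtMk hA hAK hK)
    (surjective_collapseExtMk hA hAK hK)).1
    ((hP.of_isProperMap (isProperMap_collapseExtMk hKc subset_rfl hK)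
      (surjective_collapseExtMk hKc subset_rfl hK)).2
      (collapseExt_self_prop hK hP hKc hK0 hlam))

end CollapseExt

/-! ### Coatoms in a partially ordered set -/

section Order

variable {E E' : Type*} [PartialOrder E] [PartialOrder E']

/-- An element is submaximal if it is not maximal, but everything above it is. -/
def IsSubmax (c : E) : Prop := ¬ IsMax c ∧ ∀ d, c < d → IsMax d

/-- A submaximal element is isolated if some element below it lies under no other submaximal
element. -/
def IsIsolatedSubmax (c : E) : Prop :=
  IsSubmax c ∧ ∃ d < c, ∀ c', IsSubmax c' → d ≤ c' → c' = c

theorem IsSubmax.map {c : E} (h : IsSubmax c) (φ : E ≃o E') : IsSubmax (φ c) :=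
  ⟨by rw [φ.isMax_apply]; exact h.1, fun d hd => by
    rw [← φ.symm.isMax_apply]
    exact h.2 _ (by rwa [← φ.lt_iff_lt, φ.apply_symm_apply])⟩

theorem IsIsolatedSubmax.map {c : E} (h : IsIsolatedSubmax c) (φ : E ≃o E') :
    IsIsolatedSubmax (φ c) := by
  obtain ⟨hc, d, hdc, hd⟩ := h
  refine ⟨hc.map φ, φ d, φ.lt_iff_lt.2 hdc, fun c' hc' hdc' => ?_⟩
  rw [← hd _ (hc'.map φ.symm) (by rwa [← φ.le_iff_le, φ.apply_symm_apply]),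
    φ.apply_symm_apply]

/-- If the closed subsets of spaces `V` and `V'` are induced by families of isolated submaximal
elements of order-isomorphic posets, then `V` and `V'` are homeomorphic. -/
theorem nonempty_homeomorph_of_orderIso {V V' : Type*} [TopologicalSpace V] [TopologicalSpace V']
    (φ : E ≃o E') {a : V → E} {a' : V' → E'} (ha : Function.Injective a)
    (ha' : Function.Injective a') (hr : range a = {c | IsIsolatedSubmax c})
    (hr' : range a' = {c | IsIsolatedSubmax c})
    (hc : ∀ C : Set V, IsClosed C ↔ ∃ e, {v | e ≤ a v} = C)
    (hc' : ∀ C : Set V', IsClosed C ↔ ∃ e, {v | e ≤ a' v} = C) : Nonempty (V ≃ₜ V') := by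
  have h1 : ∀ v, ∃ v', a' v' = φ (a v) := fun v => by
    have h : IsIsolatedSubmax (a v) := hr.le ⟨v, rfl⟩
    exact hr'.ge (h.map φ)
  have h2 : ∀ v', ∃ v, a v = φ.symm (a' v') := fun v' => by
    have h : IsIsolatedSubmax (a' v') := hr'.le ⟨v', rfl⟩
    exact hr.ge (h.map φ.symm)
  choose f hf using h1
  choose g hg using h2
  refine ⟨⟨⟨f, g, fun v => ha ?_, fun v' => ha' ?_⟩, ?_, ?_⟩⟩
  · rw [hg, hf, φ.symm_apply_apply]
  · rw [hf, hg, φ.apply_symm_apply]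
  · refine continuous_iff_isClosed.2 fun C hC => ?_
    obtain ⟨e, rfl⟩ := (hc' C).1 hC
    refine (hc _).2 ⟨φ.symm e, ?_⟩
    ext v
    simp [hf, φ.symm_apply_le]
  · refine continuous_iff_isClosed.2 fun C hC => ?_
    obtain ⟨e, rfl⟩ := (hc C).1 hC
    refine (hc' _).2 ⟨φ e, ?_⟩
    ext v
    simp [hg, φ.le_symm_apply]

end Order

/-- A poset whose elements are encoded by a closed set `k e` with `F ⊆ k e ⊆ Z` and an
equivalence relation `r e` on `B` that is trivial off `k e`, ordered by reverse inclusion. -/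
structure IsRemainderOrder {E B : Type*} [PartialOrder E] [TopologicalSpace B] (F Z : Set B)
    (k : E → Set B) (r : E → B → B → Prop) : Prop where
  le_iff : ∀ e e', e ≤ e' ↔ k e' ⊆ k e ∧ ∀ z w, r e' z w → r e z w
  isClosed : ∀ e, IsClosed (k e)
  subset_left : ∀ e, F ⊆ k e
  subset_right : ∀ e, k e ⊆ Z
  refl : ∀ e z, r e z z
  symm : ∀ e z w, r e z w → r e w z
  mem : ∀ e z w, r e z w → z ≠ w → z ∈ k e
  exists_mk : ∀ K A, IsClosed K → IsClosed A → A ⊆ K → F ⊆ K → K ⊆ Z →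
    ∃ e, k e = K ∧ ∀ z w, r e z w ↔ z = w ∨ z ∈ A ∧ w ∈ A

/-! ### Submaximal elements of a remainder order -/

namespace IsRemainderOrder

variable {E B : Type*} [PartialOrder E] [TopologicalSpace B] {F Z : Set B}
  {k : E → Set B} {r : E → B → B → Prop}

theorem le_of_rel (D : IsRemainderOrder F Z k r) {e c : E} {a b : B} (hk : k c ⊆ k e)
    (hc : ∀ z w, r c z w ↔ z = w ∨ z = a ∧ w = b ∨ z = b ∧ w = a) (h : r e a b) : e ≤ c := by
  refine (D.le_iff _ _).2 ⟨hk, fun z w hzw => ?_⟩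
  rcases (hc z w).1 hzw with rfl | ⟨rfl, rfl⟩ | ⟨rfl, rfl⟩
  · exact D.refl _ _
  · exact h
  · exact D.symm _ _ _ h

theorem le_of_trivial (D : IsRemainderOrder F Z k r) {e c : E} (hk : k c ⊆ k e)
    (hc : ∀ z w, r c z w → z = w) : e ≤ c :=
  (D.le_iff _ _).2 ⟨hk, fun z w hzw => hc z w hzw ▸ D.refl _ _⟩

theorem exists_trivial (D : IsRemainderOrder F Z k r) {K : Set B} (hK : IsClosed K) (hF : F ⊆ K)
    (hZ : K ⊆ Z) : ∃ e, k e = K ∧ ∀ z w, r e z w → z = w := by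
  obtain ⟨e, he, hr⟩ := D.exists_mk K ∅ hK isClosed_empty (empty_subset _) hF hZ
  exact ⟨e, he, fun z w h => by simpa using (hr z w).1 h⟩

theorem isMax_iff (D : IsRemainderOrder F Z k r) (hF : IsClosed F) (hFZ : F ⊆ Z) {e : E} :
    IsMax e ↔ k e ⊆ F ∧ ∀ z w, r e z w → z = w := by
  constructor
  · intro h
    obtain ⟨m, hm, hr⟩ := D.exists_trivial hF subset_rfl hFZ
    have hem : e ≤ m := D.le_of_trivial (hm ▸ D.subset_left e) hr
    have hme := (D.le_iff _ _).1 (h hem)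
    exact ⟨hm ▸ hme.1, fun z w hzw => hr z w (hme.2 z w hzw)⟩
  · exact fun h d _ => D.le_of_trivial (h.1.trans (D.subset_left d)) h.2

theorem isSubmax_of_insert (D : IsRemainderOrder F Z k r) (hF : IsClosed F) (hFZ : F ⊆ Z) {c : E}
    {p : B} (hp : p ∉ F) (hc : k c = insert p F) (hr : ∀ z w, r c z w → z = w) : IsSubmax c := by
  refine ⟨fun h => hp (((D.isMax_iff hF hFZ).1 h).1 (hc ▸ mem_insert _ _)), fun d hd => ?_⟩
  have h := (D.le_iff _ _).1 hd.le
  refine (D.isMax_iff hF hFZ).2 ⟨?_, fun z w hzw => hr z w (h.2 z w hzw)⟩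
  intro z hz
  rcases (hc ▸ h.1) hz with rfl | hzF
  · exact absurd (D.le_of_trivial (hc ▸ insert_subset hz (D.subset_left d)) hr) hd.not_ge
  · exact hzF

theorem isSubmax_of_pair (D : IsRemainderOrder F Z k r) (hF : IsClosed F) (hFZ : F ⊆ Z) {c : E}
    {a b : B} (hab : a ≠ b) (hc : k c = F)
    (hr : ∀ z w, r c z w ↔ z = w ∨ z = a ∧ w = b ∨ z = b ∧ w = a) : IsSubmax c := by
  refine ⟨fun h => hab (((D.isMax_iff hF hFZ).1 h).2 a b ((hr a b).2 (by simp))), fun d hd => ?_⟩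
  have h := (D.le_iff _ _).1 hd.le
  have hnot : ¬ r d a b := fun hdab =>
    hd.not_ge (D.le_of_rel (hc ▸ D.subset_left d) hr hdab)
  refine (D.isMax_iff hF hFZ).2 ⟨hc ▸ h.1, fun z w hzw => ?_⟩
  rcases (hr z w).1 (h.2 z w hzw) with rfl | ⟨rfl, rfl⟩ | ⟨rfl, rfl⟩
  · rfl
  · exact absurd hzw hnot
  · exact absurd (D.symm _ _ _ hzw) hnot

variable [T1Space B]

theorem exists_pair (D : IsRemainderOrder F Z k r) {K : Set B} (hK : IsClosed K) (hF : F ⊆ K)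
    (hZ : K ⊆ Z) {a b : B} (ha : a ∈ K) (hb : b ∈ K) :
    ∃ e, k e = K ∧ ∀ z w, r e z w ↔ z = w ∨ z = a ∧ w = b ∨ z = b ∧ w = a := by
  obtain ⟨e, he, hr⟩ := D.exists_mk K {a, b} hK (toFinite _).isClosed
    (by rintro x (rfl | rfl) <;> assumption) hF hZ
  refine ⟨e, he, fun z w => (hr z w).trans ?_⟩
  simp only [mem_insert_iff, mem_singleton_iff]
  grind

theorem isIsolatedSubmax_of_insert (D : IsRemainderOrder F Z k r) (hF : IsClosed F)
    (hFZ : F ⊆ Z) (hF0 : F.Nonempty) {c : E} {p : B} (hp : p ∉ F) (hpZ : p ∈ Z)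
    (hc : k c = insert p F) (hr : ∀ z w, r c z w → z = w) : IsIsolatedSubmax c := by
  refine ⟨D.isSubmax_of_insert hF hFZ hp hc hr, ?_⟩
  obtain ⟨q, hq⟩ := hF0
  have hpq : p ≠ q := fun h => hp (h ▸ hq)
  have hcl : IsClosed (insert p F) := isClosed_singleton.union hF
  -- The witness glues `p` to a point `q` of `F`. An element above it whose closed set omits `p`
  -- cannot retain this identification, hence is maximal.
  obtain ⟨d, hd, hdr⟩ := D.exists_pair hcl (subset_insert p F) (insert_subset hpZ hFZ)
    (mem_insert p F) (mem_insert_of_mem p hq)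
  refine ⟨d, lt_of_le_not_ge (D.le_of_trivial (hc.trans hd.symm).le hr) fun h =>
    hpq (hr p q (((D.le_iff _ _).1 h).2 p q ((hdr p q).2 (by simp)))), fun c' hc' hdc' => ?_⟩
  have h := (D.le_iff _ _).1 hdc'
  by_cases hpc : p ∈ k c'
  · have hle : c' ≤ c := D.le_of_trivial (hc ▸ insert_subset hpc (D.subset_left c')) hr
    refine hle.eq_or_lt.resolve_right fun hlt => ?_
    exact hp (((D.isMax_iff hF hFZ).1 (hc'.2 c hlt)).1 (hc ▸ mem_insert _ _))
  · refine absurd ((D.isMax_iff hF hFZ).2 ⟨fun z hz => ?_, fun z w hzw => ?_⟩) hc'.1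
    · exact ((hd ▸ h.1) hz).resolve_left fun hzp => hpc (hzp ▸ hz)
    · rcases (hdr z w).1 (h.2 z w hzw) with rfl | ⟨rfl, rfl⟩ | ⟨rfl, rfl⟩
      · rfl
      · exact absurd (D.mem _ _ _ hzw hpq) hpc
      · exact absurd (D.mem _ _ _ (D.symm _ _ _ hzw) hpq) hpc

/-- An element whose closed set exceeds `F` lies below some point element. It remains to exclude `k
c = F`. -/
theorem exists_of_isIsolatedSubmax (D : IsRemainderOrder F Z k r) (hF : IsClosed F) (hFZ : F ⊆ Z)
    {c : E} (h : IsIsolatedSubmax c) :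
    ∃ p ∈ Z \ F, k c = insert p F ∧ ∀ z w, r c z w → z = w := by
  have key : ∀ e, ¬ k e ⊆ F → ∃ p ∈ Z \ F, ∃ a, k a = insert p F ∧ (∀ z w, r a z w → z = w) ∧
      e ≤ a := by
    intro e he
    obtain ⟨p, hpe, hp⟩ := not_subset.1 he
    have hpZ := D.subset_right e hpe
    obtain ⟨a, ha, hr⟩ := D.exists_trivial (isClosed_singleton.union hF)
      (subset_insert p F) (insert_subset hpZ hFZ)
    exact ⟨p, ⟨hpZ, hp⟩, a, ha, hr,
      D.le_of_trivial (ha ▸ insert_subset hpe (D.subset_left e)) hr⟩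
  obtain ⟨hc, d, hdc, hd⟩ := h
  by_cases hkc : k c ⊆ F
  · exfalso
    have hkc' : k c = F := hkc.antisymm (D.subset_left c)
    by_cases hkd : k d ⊆ F
    -- Each pair identified by `d` gives a submaximal element above `d`, which must be `c`. So `c`
    -- identifies all these pairs, whence `c ≤ d`.
    · refine hdc.not_ge ((D.le_iff _ _).2 ⟨hkd.trans (D.subset_left c), fun x y hxy => ?_⟩)
      by_cases hne : x = y
      · exact hne ▸ D.refl _ _
      obtain ⟨i, hi, hir⟩ := D.exists_pair hF subset_rfl hFZ (hkd (D.mem _ _ _ hxy hne))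
        (hkd (D.mem _ _ _ (D.symm _ _ _ hxy) (Ne.symm hne)))
      rw [← hd i (D.isSubmax_of_pair hF hFZ hne hi hir)
        (D.le_of_rel (hi ▸ D.subset_left d) hir hxy)]
      exact (hir x y).2 (by simp)
    · obtain ⟨p, hp, a, ha, har, hda⟩ := key d hkd
      have hac := hd a (D.isSubmax_of_insert hF hFZ hp.2 ha har) hda
      exact hp.2 (hkc (hac ▸ ha ▸ mem_insert _ _))
  · obtain ⟨p, hp, a, ha, har, hca⟩ := key c hkc
    rcases hca.eq_or_lt with rfl | hlt
    · exact ⟨p, hp, ha, har⟩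
    · exact absurd (hc.2 a hlt) (D.isSubmax_of_insert hF hFZ hp.2 ha har).1

/-- The closed subsets of `Z \ F` are induced by a family of isolated submaximal elements. -/
theorem exists_family (D : IsRemainderOrder F Z k r) (hF : IsClosed F) (hZ : IsClosed Z)
    (hFZ : F ⊆ Z) (hF0 : F.Nonempty) :
    ∃ a : (Z \ F : Set B) → E, Function.Injective a ∧ range a = {c | IsIsolatedSubmax c} ∧
      ∀ C : Set (Z \ F : Set B), IsClosed C ↔ ∃ e, {v | e ≤ a v} = C := by
  have hex : ∀ p : (Z \ F : Set B), ∃ e, k e = insert p.1 F ∧ ∀ z w, r e z w → z = w :=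
    fun p => D.exists_trivial (isClosed_singleton.union hF) (subset_insert p.1 F)
      (insert_subset p.2.1 hFZ)
  choose a ha har using hex
  have hle : ∀ e p, e ≤ a p ↔ p.1 ∈ k e := by
    refine fun e p => ⟨fun h => ((D.le_iff _ _).1 h).1 (ha p ▸ mem_insert _ _), fun h =>
      D.le_of_trivial (ha p ▸ insert_subset h (D.subset_left e)) (har p)⟩
  refine ⟨a, fun p q hpq => Subtype.ext ?_, ?_, fun C => ⟨fun hC => ?_, ?_⟩⟩
  · have h : p.1 ∈ insert q.1 F := by rw [← ha q, ← hpq, ha p]; exact mem_insert _ _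
    exact h.resolve_right p.2.2
  · refine Subset.antisymm ?_ fun c hc => ?_
    · rintro _ ⟨p, rfl⟩
      exact D.isIsolatedSubmax_of_insert hF hFZ hF0 p.2.2 p.2.1 (ha p) (har p)
    · obtain ⟨p, hp, hcp, hcr⟩ := D.exists_of_isIsolatedSubmax hF hFZ hc
      refine ⟨⟨p, hp⟩, le_antisymm ?_ ?_⟩
      · exact D.le_of_trivial (hcp.trans (ha ⟨p, hp⟩).symm).le hcr
      · exact (hle c ⟨p, hp⟩).2 (hcp ▸ mem_insert _ _)
  · obtain ⟨G, hG, rfl⟩ := isClosed_induced_iff.1 hC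
    -- The set (G ∩ Z) ∪ F is admissible and meets `Z \ F` in the same points as `G`.
    obtain ⟨e, he, -⟩ := D.exists_trivial ((hG.inter hZ).union hF) subset_union_right
      (union_subset inter_subset_right hFZ)
    refine ⟨e, ?_⟩
    ext p
    have h1 := p.2.1
    have h2 := p.2.2
    simp [hle, he, h1, h2]
  · rintro ⟨e, rfl⟩
    simp only [hle]
    exact (D.isClosed e).preimage continuous_subtype_val

end IsRemainderOrder

namespace ExtSet

variable {P : SpaceProperty.{u}} {X : Type u} [TopologicalSpace X]

/-- The preimage in `βX` of the remainder of a class of extensions. -/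
def rem (e : ExtSet P X) : Set (StoneCech X) :=
  Quotient.lift (fun T : PreExt P X => T.1.rem) (fun T S (h : T.1.Equivalent S.1) =>
    (Extension.le_iff.1 h.symm.le).1.antisymm (Extension.le_iff.1 h.le).1) e

/-- The kernel of the mapping of `βX` onto the Stone–Čech compactification of an extension. -/
def ker (e : ExtSet P X) : StoneCech X → StoneCech X → Prop :=
  Quotient.lift (fun (T : PreExt P X) z w => T.1.bmap z = T.1.bmap w) (fun T S (h : T.1.Equivalent S.1) =>
    funext fun z => funext fun w => propext
      ⟨(Extension.le_iff.1 h.symm.le).2 z w, (Extension.le_iff.1 h.le).2 z w⟩) e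

theorem isRemainderOrder (hP : IsCompactnessLike P) [T35Space X] (hX : ¬ P X) :
    IsRemainderOrder (E := ExtSet P X) (lam P X)ᶜ (range stoneCechUnit)ᶜ rem ker where
  le_iff := by
    rintro ⟨T⟩ ⟨S⟩
    exact Extension.le_iff
  isClosed := by
    rintro ⟨T⟩
    exact Extension.isClosed_rem T.2.2
  subset_left := by
    rintro ⟨T⟩
    exact Extension.lam_compl_subset_rem hP T.2.1 T.2.2
  subset_right := by
    rintro ⟨T⟩
    exact T.1.disjoint_rem.subset_compl_right
  refl := by
    rintro ⟨T⟩ z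
    exact rfl
  symm := by
    rintro ⟨T⟩ z w h
    exact Eq.symm h
  mem := by
    rintro ⟨T⟩ z w h hne
    exact Extension.mem_rem_of_bmap_eq T.2.2 hne h
  exists_mk := by
    intro K A hK hA hAK hF hZ
    have hd : Disjoint K (range stoneCechUnit) := disjoint_left.2 hZ
    refine ⟨Quotient.mk _ ⟨collapseExt hA hAK hd, ?_, ?_⟩, ?_, fun z w => ?_⟩
    · exact collapseExt_prop hA hAK hd hP hK ((lam_compl_nonempty hP hX).mono hF) hF
    · exact isCompact_compl_range_collapseExt hA hAK hd hK
    · exact collapseExt_rem hA hAK hd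
    · exact collapseExt_bmap_eq_iff hA hAK hd

end ExtSet

/-- Local compactness makes βX ∖ X closed, locally-`P` puts the complement of `lam P X` inside it,
and non-`P` makes that complement nonempty. -/
theorem exists_family_lamRemainder {P : SpaceProperty.{u}} (hP : IsCompactnessLike P)
    (X : Type u) [TopologicalSpace X] [T35Space X] [LocallyCompactSpace X]
    (hX : IsLocally P X) (hX' : ¬ P X) :
    ∃ a : lamRemainder P X → ExtSet P X, Function.Injective a ∧
      range a = {c | IsIsolatedSubmax c} ∧
      ∀ C : Set (lamRemainder P X), IsClosed C ↔ ∃ e, {v | e ≤ a v} = C := by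
  have h : lamRemainder P X = (range stoneCechUnit)ᶜ \ (lam P X)ᶜ := by
    rw [lamRemainder, sdiff_eq, sdiff_eq, compl_compl, inter_comm]
  rw [h]
  exact (ExtSet.isRemainderOrder hP hX').exists_family isOpen_lam.isClosed_compl
    isOpen_range_stoneCechUnit.isClosed_compl (compl_subset_compl.2 (range_subset_lam hP hX))
    (lam_compl_nonempty hP hX')

end CompactRemainder

theorem mainTheorem6 (P : CompactRemainder.SpaceProperty.{u})
    (hP : CompactRemainder.IsCompactnessLike P)
    (X Y : Type u) [TopologicalSpace X] [T35Space X] [TopologicalSpace Y] [T35Space Y]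
    [LocallyCompactSpace X] [LocallyCompactSpace Y]
    (hX : CompactRemainder.IsLocally P X) (hX' : ¬ P X)
    (hY : CompactRemainder.IsLocally P Y) (hY' : ¬ P Y)
    (h : Nonempty (CompactRemainder.ExtSet P X ≃o CompactRemainder.ExtSet P Y)) :
    Nonempty (CompactRemainder.lamRemainder P X ≃ₜ CompactRemainder.lamRemainder P Y) := by
  obtain ⟨φ⟩ := h
  obtain ⟨a, ha, hr, hc⟩ := CompactRemainder.exists_family_lamRemainder hP X hX hX'
  obtain ⟨a', ha', hr', hc'⟩ := CompactRemainder.exists_family_lamRemainder hP Y hY hY'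
  exact CompactRemainder.nonempty_homeomorph_of_orderIso φ ha ha' hr hr' hc hc'
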